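/- Let $R$ be a Cohen–Macaulay domain, that is, a Noetherian integral domain such that for every maximal ideal $\mathfrak m$ the depth of $R_{\mathfrak m}$ equals its Krull dimension. For a finitely generated $R$-module $M$ the trace of $M$ is the ideal $\operatorname{tr}(M)=\sum_{\varphi\in\operatorname{Hom}_R(M,R)}\varphi(M)$, and an ideal $I\subseteq R$ is called a trace ideal if $I=\operatorname{tr}(M)$ for some finitely generated $R$-module $M$. The grade of a proper ideal $I$ is the supremum of the lengths of $R$-regular sequences contained in $I$, and $\operatorname{grade}(R)=\infty$. Then the following conditions are equivalent: (i) for every nonzero ideal $I$ of $R$, $I$ is a trace ideal if and only if $\operatorname{grade}(I)>1$; (ii) $R$ is normal, i.e. integrally closed in its field of fractions. -/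

import Mathlib

universe u v

/-- The trace of an `R`-module `M`: the sum of the images of all linear maps `M → R`. -/
def moduleTrace (R : Type u) [CommRing R] (M : Type v) [AddCommGroup M] [Module R M] : Ideal R :=
  ⨆ φ : M →ₗ[R] R, LinearMap.range φ

/-- A trace ideal is the trace of a finitely generated module. Every finitely generated module is
isomorphic to one in the universe of `R`, so restricting to that universe loses nothing. -/
def IsTraceIdeal {R : Type u} [CommRing R] (I : Ideal R) : Prop :=
  ∃ (M : Type u) (_ : AddCommGroup M) (_ : Module R M),
    Module.Finite R M ∧ I = moduleTrace R M

open Classical in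
/-- The grade of an ideal: the supremum of the lengths of `R`-regular sequences contained in `I`
if `I` is proper, and `∞` for the unit ideal. -/
noncomputable def idealGrade {R : Type u} [CommRing R] (I : Ideal R) : ℕ∞ :=
  if I = ⊤ then ⊤
  else ⨆ (rs : List R) (_ : (∀ r ∈ rs, r ∈ I) ∧ RingTheory.Sequence.IsRegular R rs),
    (rs.length : ℕ∞)

/-- A local ring is Cohen–Macaulay if it is Noetherian and its depth (the grade of the maximal
ideal) equals its Krull dimension. -/
def IsCohenMacaulayLocal (R : Type u) [CommRing R] [IsLocalRing R] : Prop :=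
  IsNoetherianRing R ∧ ((idealGrade (IsLocalRing.maximalIdeal R) : ℕ∞) : WithBot ℕ∞) = ringKrullDim R

/-- A ring is Cohen–Macaulay if it is Noetherian and its localizations at maximal ideals are
Cohen–Macaulay local rings. -/
def IsCohenMacaulay (R : Type u) [CommRing R] : Prop :=
  IsNoetherianRing R ∧
    ∀ (m : Ideal R) [m.IsMaximal], IsCohenMacaulayLocal (Localization.AtPrime m)

/-! Let K be the fraction field and J = (R : I) in K. Forms on a nonzero ideal I are multiplications
by elements of J, so I is a trace ideal iff J I ⊆ I. Grade at least two forces J = R, hence I is a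
trace ideal. If R is normal and I is a trace ideal, elements of J stabilise the finitely generated
I, so are integral and J = R; grade one would put I in an associated prime of R/(a), yielding c/a in
J outside R. Conversely, for x in K integral over R, the conductor of R[x] is a nonzero trace ideal.
If its grade exceeds one, then x, which multiplies it into R, lies in R. -/

theorem apply_mem_moduleTrace {R : Type u} [CommRing R] {M : Type v} [AddCommGroup M] [Module R M]
    (φ : M →ₗ[R] R) (m : M) : φ m ∈ moduleTrace R M :=
  le_iSup (fun φ : M →ₗ[R] R => LinearMap.range φ) φ ⟨m, rfl⟩

/-- An ideal of a Noetherian ring is a trace ideal if and only if every linear form on it takes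
values in it. -/
theorem isTraceIdeal_iff_forall_apply_mem {R : Type u} [CommRing R] [IsNoetherianRing R]
    {I : Ideal R} : IsTraceIdeal I ↔ ∀ (φ : I →ₗ[R] R) (x : I), φ x ∈ I := by
  constructor
  · rintro ⟨M, _, _, _, rfl⟩ φ x
    suffices h : moduleTrace R M ≤
        Submodule.map (Submodule.subtype (moduleTrace R M))
          (Submodule.comap φ (moduleTrace R M)) by
      obtain ⟨y, hy, hyx⟩ := h x.2
      rwa [Subtype.ext hyx] at hy
    refine iSup_le fun ψ => ?_
    rintro _ ⟨m, rfl⟩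
    let ψ' : M →ₗ[R] moduleTrace R M := ψ.codRestrict _ (apply_mem_moduleTrace ψ)
    exact ⟨ψ' m, apply_mem_moduleTrace (φ ∘ₗ ψ') m, rfl⟩
  · intro h
    refine ⟨I, inferInstance, inferInstance, inferInstance, le_antisymm ?_ ?_⟩
    · intro x hx
      exact apply_mem_moduleTrace (Submodule.subtype I) ⟨x, hx⟩
    · refine iSup_le fun φ => ?_
      rintro _ ⟨x, rfl⟩
      exact h φ x

open scoped Pointwise in
theorem isSMulRegular_quotSMulTop_self_iff {R : Type u} [CommRing R] (a b : R) :
    IsSMulRegular (QuotSMulTop a R) b ↔ ∀ x, a ∣ b * x → a ∣ x := by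
  have mem (y : R) : y ∈ a • (⊤ : Submodule R R) ↔ a ∣ y := by
    simp [Submodule.mem_smul_pointwise_iff_exists, dvd_def, eq_comm]
  simp only [QuotSMulTop, isSMulRegular_quotient_iff_mem_of_smul_mem, mem, smul_eq_mul]

/-- In a domain, an ideal has grade at least two if and only if it is the unit ideal or contains
a regular sequence of length two. -/
theorem one_lt_idealGrade_iff {R : Type u} [CommRing R] [IsDomain R] {I : Ideal R} :
    1 < idealGrade I ↔
      I = ⊤ ∨ ∃ a ∈ I, ∃ b ∈ I, a ≠ 0 ∧ ∀ x, a ∣ b * x → a ∣ x := by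
  by_cases hI : I = ⊤
  · simp [idealGrade, hI]
  simp only [idealGrade, hI, if_false, false_or, lt_iSup_iff, exists_prop]
  constructor
  · rintro ⟨rs, ⟨hmem, hreg⟩, hlen⟩
    match rs, hlen with
    | [], hlen => simp at hlen
    | [a], hlen => simp at hlen
    | a :: b :: rs, _ =>
      rw [RingTheory.Sequence.isRegular_cons_iff, RingTheory.Sequence.isRegular_cons_iff,
        isSMulRegular_quotSMulTop_self_iff] at hreg
      refine ⟨a, hmem a (by simp), b, hmem b (by simp), ?_, hreg.2.1⟩
      rintro rfl
      exact zero_ne_one (hreg.1 (by simp : (0 : R) • (0 : R) = (0 : R) • (1 : R)))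
  · rintro ⟨a, ha, b, hb, ha0, hreg⟩
    have hmem : ∀ r ∈ [a, b], r ∈ I := by simp [ha, hb]
    refine ⟨[a, b], ⟨hmem, ⟨?_, fun h => hI ?_⟩⟩, by simp⟩
    · rw [RingTheory.Sequence.isWeaklyRegular_cons_iff, RingTheory.Sequence.isWeaklyRegular_cons_iff,
        isSMulRegular_quotSMulTop_self_iff]
      exact ⟨fun x y h => mul_left_cancel₀ ha0 h, hreg, .nil _ _⟩
    · rw [smul_eq_mul, Ideal.mul_top] at h
      exact top_le_iff.mp (h.le.trans (Ideal.span_le.mpr hmem))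

/-- Both sides equal φ(xy). In a domain this makes the ratio φ(x)/x independent of x ≠ 0, so φ is
multiplication by a fraction. -/
theorem Ideal.mul_linearMap_apply_comm {R : Type u} [CommRing R] {I : Ideal R} (φ : I →ₗ[R] R) (x y : I) :
    (x : R) * φ y = y * φ x := by
  rw [← smul_eq_mul, ← smul_eq_mul, ← map_smul, ← map_smul]
  exact congrArg φ (Subtype.ext (mul_comm _ _))

/-- In a Noetherian domain, ideals of grade at least two are trace ideals. -/
theorem isTraceIdeal_of_one_lt_idealGrade {R : Type u} [CommRing R] [IsDomain R]
    [IsNoetherianRing R] {I : Ideal R} (h : 1 < idealGrade I) : IsTraceIdeal I := by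
  rw [isTraceIdeal_iff_forall_apply_mem]
  intro φ x
  obtain rfl | ⟨a, ha, b, hb, ha0, hreg⟩ := one_lt_idealGrade_iff.mp h
  · trivial
  -- From b φ(a) = a φ(b), regularity of b modulo a gives a ∣ φ(a); the quotient c is the multiplier
  -- of φ.
  obtain ⟨c, hc⟩ := hreg (φ ⟨a, ha⟩) ⟨φ ⟨b, hb⟩, Ideal.mul_linearMap_apply_comm φ ⟨b, hb⟩ ⟨a, ha⟩⟩
  have hx : φ x = x * c := mul_left_cancel₀ ha0 <| by
    rw [Ideal.mul_linearMap_apply_comm φ ⟨a, ha⟩ x, hc]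
    ring
  exact hx ▸ I.mul_mem_right c x.2

/-- For a nonzero trace ideal `I` of a normal Noetherian domain, a fraction `c / a` with
`(c / a) I ⊆ R` lies in `R`. -/
theorem dvd_of_forall_dvd_mul_of_isTraceIdeal {R : Type u} [CommRing R] [IsDomain R]
    [IsNoetherianRing R] [IsIntegrallyClosed R] {I : Ideal R} (hI : I ≠ ⊥) (h : IsTraceIdeal I)
    {a c : R} (ha : a ≠ 0) (hc : ∀ i ∈ I, a ∣ c * i) : a ∣ c := by
  choose f hf using fun i : I => hc i i.2
  let φ : I →ₗ[R] R :=
    { toFun := f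
      map_add' := fun x y => mul_left_cancel₀ ha <| by
        rw [← hf, mul_add, ← hf, ← hf, Submodule.coe_add, mul_add]
      map_smul' := fun r x => mul_left_cancel₀ ha <| by
        rw [← hf, RingHom.id_apply, smul_eq_mul, mul_left_comm, ← hf, Submodule.coe_smul,
          smul_eq_mul, mul_left_comm] }
  have hφ := isTraceIdeal_iff_forall_apply_mem.mp h φ
  have haK : algebraMap R (FractionRing R) a ≠ 0 := by simpa using ha
  have hint : IsIntegral R (algebraMap R (FractionRing R) c /
      algebraMap R (FractionRing R) a) := by
    -- Determinant trick: c/a maps the nonzero finitely generated module I into itself.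
    refine isIntegral_of_smul_mem_submodule (M := FractionRing R)
      (Submodule.map (Algebra.linearMap R (FractionRing R)) I) ?_ ?_ _ ?_
    · rw [Submodule.ne_bot_iff] at hI ⊢
      obtain ⟨x, hx, hx0⟩ := hI
      exact ⟨algebraMap R (FractionRing R) x, ⟨x, hx, rfl⟩, by simpa using hx0⟩
    · exact (IsNoetherian.noetherian I).map _
    · rintro _ ⟨i, hi, rfl⟩
      refine ⟨f ⟨i, hi⟩, hφ ⟨i, hi⟩, ?_⟩
      have := congrArg (algebraMap R (FractionRing R)) (hf ⟨i, hi⟩)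
      simp only [map_mul] at this
      simp only [Algebra.linearMap_apply, smul_eq_mul]
      field_simp
      rw [this, mul_comm]
  obtain ⟨y, hy⟩ := IsIntegrallyClosed.isIntegral_iff.mp hint
  refine ⟨y, IsFractionRing.injective R (FractionRing R) ?_⟩
  rw [map_mul, hy, mul_div_cancel₀ _ haK]

/-- In a normal Noetherian domain, nonzero trace ideals have grade at least two. -/
theorem one_lt_idealGrade_of_isTraceIdeal {R : Type u} [CommRing R] [IsDomain R]
    [IsNoetherianRing R] [IsIntegrallyClosed R] {I : Ideal R} (hI : I ≠ ⊥) (h : IsTraceIdeal I) :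
    1 < idealGrade I := by
  obtain ⟨a, ha, ha0⟩ := (Submodule.ne_bot_iff I).mp hI
  refine one_lt_idealGrade_iff.mpr (Or.inr ⟨a, ha, ?_⟩)
  simp only [← isSMulRegular_quotSMulTop_self_iff]
  by_contra! hreg
  -- Prime avoidance: I consists of zero divisors on R/(a), so it lies in a single associated prime,
  -- the annihilator of the class of some c.
  obtain ⟨P, hP, hIP⟩ := (I.subset_union_prime_finite
      (associatedPrimes.finite R (R ⧸ Ideal.span {a})) (f := id) 0 0 fun _ h _ _ => h.1).1 <| by
    simp only [id, biUnion_associatedPrimes_eq_compl_regular]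
    intro b hb hb'
    refine hreg b hb ha0 ((isSMulRegular_quotSMulTop_self_iff a b).mpr fun x hx => ?_)
    rw [← Ideal.mem_span_singleton] at hx ⊢
    exact mem_of_isSMulRegular_quotient_of_smul_mem hb' hx
  rw [AssociatedPrimes.mem_iff, isAssociatedPrime_iff] at hP
  obtain ⟨hprime, x, rfl⟩ := hP
  obtain ⟨c, rfl⟩ := Ideal.Quotient.mk_surjective x
  have key (r : R) : r ∈ (⊥ : Submodule R (R ⧸ Ideal.span {a})).colon
      {Ideal.Quotient.mk (Ideal.span {a}) c} ↔ a ∣ c * r := by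
    rw [Submodule.mem_colon_singleton, Submodule.mem_bot, ← Ideal.mem_span_singleton,
      ← Ideal.Quotient.eq_zero_iff_mem, mul_comm, map_mul]
    rfl
  refine hprime.ne_top ((Ideal.eq_top_iff_one _).mpr ((key 1).mpr ?_))
  rw [mul_one]
  exact dvd_of_forall_dvd_mul_of_isTraceIdeal hI h ha0 fun i hi => (key i).mp (hIP hi)

/-- The conductor of a subalgebra `S` of an `R`-algebra into (the image of) `R`. -/
def Subalgebra.conductorIdeal {R : Type u} [CommRing R] {K : Type v} [CommRing K] [Algebra R K]
    (S : Subalgebra R K) : Ideal R where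
  carrier := {r | ∀ s ∈ S, ∃ t, algebraMap R K t = algebraMap R K r * s}
  add_mem' {x y} hx hy s hs := by
    obtain ⟨t, ht⟩ := hx s hs
    obtain ⟨u, hu⟩ := hy s hs
    exact ⟨t + u, by rw [map_add, map_add, ht, hu, add_mul]⟩
  zero_mem' s _ := ⟨0, by simp⟩
  smul_mem' c x hx s hs := by
    obtain ⟨t, ht⟩ := hx s hs
    exact ⟨c * t, by rw [smul_eq_mul, map_mul, map_mul, ht, mul_assoc]⟩

/-- The conductor is stable under multiplication by S, and forms on it are S-linear: φ(c)s = φ(cs) ∈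
R. -/
theorem Subalgebra.isTraceIdeal_conductorIdeal {R : Type u} [CommRing R] [IsDomain R]
    [IsNoetherianRing R] {K : Type v} [Field K] [Algebra R K] [IsFractionRing R K]
    (S : Subalgebra R K) : IsTraceIdeal S.conductorIdeal := by
  rw [isTraceIdeal_iff_forall_apply_mem]
  rintro φ ⟨c, hc⟩ s hs
  obtain rfl | hc0 := eq_or_ne c 0
  · have : φ ⟨0, hc⟩ = 0 := map_zero φ
    exact ⟨0, by simp [this]⟩
  obtain ⟨r, hr⟩ := hc s hs
  have hrC : r ∈ S.conductorIdeal := fun t ht => by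
    obtain ⟨u, hu⟩ := hc (s * t) (S.mul_mem hs ht)
    exact ⟨u, by rw [hu, hr, mul_assoc]⟩
  have hcK : algebraMap R K c ≠ 0 := by simpa using hc0
  refine ⟨φ ⟨r, hrC⟩, mul_left_cancel₀ hcK ?_⟩
  rw [← map_mul, Ideal.mul_linearMap_apply_comm φ ⟨c, hc⟩ ⟨r, hrC⟩, map_mul, hr]
  ring

/-- A Noetherian domain all of whose nonzero trace ideals have grade at least two is normal. -/
theorem isIntegrallyClosed_of_forall_isTraceIdeal {R : Type u} [CommRing R] [IsDomain R]
    [IsNoetherianRing R] (h : ∀ I : Ideal R, I ≠ ⊥ → IsTraceIdeal I → 1 < idealGrade I) :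
    IsIntegrallyClosed R := by
  let K := FractionRing R
  refine (isIntegrallyClosed_iff K).mpr fun {x} hx => ?_
  let S := Algebra.adjoin R {x}
  have hxS : x ∈ S := Algebra.self_mem_adjoin_singleton R x
  have hC : S.conductorIdeal ≠ ⊥ := by
    -- R[x] is a finite R-module, so a common denominator of its generators lies in the conductor.
    obtain ⟨a, ha, haS⟩ :=
      FractionalIdeal.isFractional_of_fg (S := nonZeroDivisors R) hx.fg_adjoin_singleton
    refine (Submodule.ne_bot_iff _).mpr ⟨a, fun s hs => ?_, nonZeroDivisors.ne_zero ha⟩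
    obtain ⟨t, ht⟩ := haS s hs
    exact ⟨t, by rw [ht, Algebra.smul_def]⟩
  obtain htop | ⟨a, ha, b, hb, ha0, hreg⟩ :=
    one_lt_idealGrade_iff.mp (h _ hC S.isTraceIdeal_conductorIdeal)
  · obtain ⟨t, ht⟩ := (Ideal.eq_top_iff_one _).mp htop x hxS
    exact ⟨t, by simpa using ht⟩
  · obtain ⟨s, hs⟩ := ha x hxS
    obtain ⟨t, ht⟩ := hb x hxS
    -- Here s = ax and t = bx, so bs = at.
    have hdvd : a ∣ b * s := ⟨t, IsFractionRing.injective R K <| by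
      rw [map_mul, map_mul, hs, ht]
      ring⟩
    obtain ⟨y, rfl⟩ := hreg s hdvd
    have haK : algebraMap R K a ≠ 0 := by simpa using ha0
    exact ⟨y, mul_left_cancel₀ haK (by rw [← hs, map_mul])⟩

theorem mainTheorem3 (R : Type u) [CommRing R] [IsDomain R] (hR : IsCohenMacaulay R) :
    (∀ I : Ideal R, I ≠ ⊥ → (IsTraceIdeal I ↔ 1 < idealGrade I)) ↔ IsIntegrallyClosed R := by
  have := hR.1
  exact ⟨fun h => isIntegrallyClosed_of_forall_isTraceIdeal fun I hI => (h I hI).mp,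
    fun _ I hI => ⟨one_lt_idealGrade_of_isTraceIdeal hI, isTraceIdeal_of_one_lt_idealGrade⟩⟩
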